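/- Let $E$ and $F$ be Banach spaces over $\mathbb{K}=\mathbb{R}$ or $\mathbb{C}$, let $B(E,F)$ be the Banach space of bounded linear operators from $E$ to $F$ with the operator norm, and let $\Lambda=B(E,F)\setminus\{0\}$. For $X\in\Lambda$ let $N(X)$ and $R(X)$ denote the null space and the range of $X$, and let $M(X)=\{T\in B(E,F): T\,N(X)\subset R(X)\}$. Suppose that $A\in\Lambda$ is double splitting, i.e. $R(A)$ is closed and there are closed subspaces $R^+\subset E$ and $N^+\subset F$ with $E=N(A)\oplus R^+$ and $F=R(A)\oplus N^+$ (equivalently, $A$ has a bounded generalized inverse). Then the family $\mathcal{F}=\{M(X)\}_{X\in\Lambda}$ is smooth integrable at $A$; that is, there is a set $S\subset\Lambda$ with $A\in S$ such that: (1) $S$ is a smooth submanifold of $B(E,F)$: for every $X\in S$ there are a splitting $B(E,F)=\mathbf{E}_0\oplus\mathbf{E}_1$ into closed subspaces, an open neighbourhood $U$ of $X$ in $B(E,F)$, and a $C^\infty$ diffeomorphism $\varphi$ (over $\mathbb{K}$) of $U$ onto an open set $\varphi(U)\subset B(E,F)$ such that $\varphi(S\cap U)$ is an open subset of $\mathbf{E}_0$;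 (2) $S$ is tangent to $M(X)$ at every $X\in S$: $M(X)=\{\dot c(0): c \text{ a } C^1\text{ curve in } S \text{ (with real parameter, defined near } 0)\text{ with } c(0)=X\}$. -/

import Mathlib

open scoped ContDiff

namespace BanachFrobenius

section Submanifolds

variable (𝕜 : Type*) [RCLike 𝕜] {V : Type*} [NormedAddCommGroup V] [NormedSpace 𝕜 V]

/-- The set of all velocities `c'(0)` of `C¹` curves `c`, defined on an open interval around `0` in
the real line, with values in `S` and with `c(0) = x`. (If the scalars are complex, curves are still
curves with a real parameter, and `V` is regarded as a real normed space.) -/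
def tangentSet (S : Set V) (x : V) : Set V :=
  letI : NormedSpace ℝ V := NormedSpace.restrictScalars ℝ 𝕜 V
  {v | ∃ (c : ℝ → V) (ε : ℝ), 0 < ε ∧ ContDiffOn ℝ 1 c (Set.Ioo (-ε) ε) ∧
    (∀ t ∈ Set.Ioo (-ε) ε, c t ∈ S) ∧ c 0 = x ∧ HasDerivAt c v 0}

/-- `S` is a smooth submanifold of the Banach space `V`: around every point of `S` there is a smooth
diffeomorphism `φ` from an open set `φ.source` onto an open set `φ.target` of `V`, with smooth
inverse, such that the image of `S ∩ φ.source` is a relatively open subset of a closed subspace `E₀`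
which splits `V`, i.e. has a closed complement `E₁`. -/
def IsSmoothSubmanifold (S : Set V) : Prop :=
  ∀ x ∈ S, ∃ (E₀ E₁ : Submodule 𝕜 V) (φ : OpenPartialHomeomorph V V),
    IsClosed (E₀ : Set V) ∧ IsClosed (E₁ : Set V) ∧ IsCompl E₀ E₁ ∧
    x ∈ φ.source ∧ ContDiffOn 𝕜 ∞ φ φ.source ∧ ContDiffOn 𝕜 ∞ φ.symm φ.target ∧
    ∃ O : Set V, IsOpen O ∧ φ '' (S ∩ φ.source) = O ∩ E₀

/-- The family of subspaces `M(x)`, `x ∈ Λ`, is smooth integrable at `x₀ ∈ Λ`: through `x₀` there is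
a smooth submanifold `S ⊆ Λ` whose tangent space at each of its points `x` is `M(x)`. Only the
values of `M` on `Λ` matter. -/
def SmoothIntegrableAt (Λ : Set V) (M : V → Submodule 𝕜 V) (x₀ : V) : Prop :=
  ∃ S : Set V, x₀ ∈ S ∧ S ⊆ Λ ∧ IsSmoothSubmanifold 𝕜 S ∧
    ∀ x ∈ S, (M x : Set V) = tangentSet 𝕜 S x

end Submanifolds

section Operators

variable {𝕜 : Type*} [RCLike 𝕜]
  {E : Type*} [NormedAddCommGroup E] [NormedSpace 𝕜 E]
  {F : Type*} [NormedAddCommGroup F] [NormedSpace 𝕜 F]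

/-- `A` is double splitting: its range is closed, and its null space and its range have closed
complements. -/
def IsDoubleSplitting (A : E →L[𝕜] F) : Prop :=
  IsClosed (Set.range A) ∧
  (∃ R : Submodule 𝕜 E, IsClosed (R : Set E) ∧ IsCompl (LinearMap.ker (A : E →ₗ[𝕜] F)) R) ∧
  (∃ N : Submodule 𝕜 F, IsClosed (N : Set F) ∧ IsCompl (LinearMap.range (A : E →ₗ[𝕜] F)) N)

/-- Cafagna's family `M(X) = {T : T N(X) ⊆ R(X)}`, as a subspace of the bounded operators. -/
def cafagna (X : E →L[𝕜] F) : Submodule 𝕜 (E →L[𝕜] F) where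
  carrier := {T | ∀ e : E, X e = 0 → T e ∈ LinearMap.range (X : E →ₗ[𝕜] F)}
  add_mem' := fun hS hT e he => Submodule.add_mem _ (hS e he) (hT e he)
  zero_mem' := fun _ _ => Submodule.zero_mem _
  smul_mem' := fun a _ hT e he => Submodule.smul_mem _ a (hT e he)

end Operators

end BanachFrobenius

/-!
If `A` has a bounded inner inverse `B`, put `G = R(A)`, `U = B|_G : G → E` and `V = A B : F → G`, so
that the compression `V A U` is the identity of `G`. Near `A` the compression `V X U` stays
invertible, `Y = U (V X U)⁻¹ V` satisfies `Y X Y = Y`, and `S` is the zero set of the Schur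
complement `σ(X) = X - X Y X`, i.e. the set of those `X` for which `Y` is also an inner inverse. The
derivative of `σ` at `X` is `T ↦ (1 - X Y) T (1 - Y X)`, whose kernel is `M(X)` when `X Y X = X`.
If `V Z = 0` and `Z U = 0`, then `σ(X + Z) = σ(X) + Z`: translations by such `Z` straighten `S`, and
`X ↦ X - σ(X)` retracts a neighbourhood onto `S`, so that every vector of the kernel is the velocity
of a curve in `S`.
-/

open Set ContinuousLinearMap

namespace BanachFrobenius

section Tangent

variable {𝕜 : Type*} [RCLike 𝕜] {V : Type*} [NormedAddCommGroup V] [NormedSpace 𝕜 V]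
  {W : Type*} [NormedAddCommGroup W] [NormedSpace 𝕜 W]

theorem tangentSet_subset_ker {S : Set V} {x : V} {σ : V → W} {L : V →L[𝕜] W}
    (hL : HasFDerivAt σ L x) (hσ : ∀ y ∈ S, σ y = 0) : tangentSet 𝕜 S x ⊆ L.ker := by
  let _ : NormedSpace ℝ V := NormedSpace.restrictScalars ℝ 𝕜 V
  let _ : NormedSpace ℝ W := NormedSpace.restrictScalars ℝ 𝕜 W
  have : IsScalarTower ℝ 𝕜 V := .of_algebraMap_smul fun _ _ => rfl
  have : IsScalarTower ℝ 𝕜 W := .of_algebraMap_smul fun _ _ => rfl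
  rintro v ⟨c, ε, hε, -, hcS, rfl, hc⟩
  have hderiv : HasDerivAt (σ ∘ c) (L v) 0 := (hL.restrictScalars ℝ).comp_hasDerivAt 0 hc
  have hzero : HasDerivAt (σ ∘ c) 0 0 := by
    refine (hasDerivAt_const (0 : ℝ) (0 : W)).congr_of_eventuallyEq ?_
    filter_upwards [Ioo_mem_nhds (neg_lt_zero.2 hε) hε] with t ht using hσ _ (hcS t ht)
  exact hderiv.unique hzero

theorem apply_mem_tangentSet {S : Set V} {Ω : Set W} {r : W → V} {L : W →L[𝕜] V} {y : W}
    (hΩ : IsOpen Ω) (hy : y ∈ Ω) (hr : ContDiffOn 𝕜 1 r Ω) (hrS : MapsTo r Ω S)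
    (hL : HasFDerivAt r L y) (w : W) : L w ∈ tangentSet 𝕜 S (r y) := by
  let _ : NormedSpace ℝ V := NormedSpace.restrictScalars ℝ 𝕜 V
  let _ : NormedSpace ℝ W := NormedSpace.restrictScalars ℝ 𝕜 W
  have : IsScalarTower ℝ 𝕜 V := .of_algebraMap_smul fun _ _ => rfl
  have : IsScalarTower ℝ 𝕜 W := .of_algebraMap_smul fun _ _ => rfl
  have hline : ContDiff ℝ 1 fun t : ℝ => y + t • w := by fun_prop
  have hline' : HasDerivAt (fun t : ℝ => y + t • w) w 0 := by
    simpa using ((hasDerivAt_id (0 : ℝ)).smul_const w).const_add y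
  have hy₀ : y = y + (0 : ℝ) • w := by simp
  obtain ⟨ε, hε, hball⟩ :=
    Metric.isOpen_iff.1 (hΩ.preimage hline.continuous) 0 (by simpa using hy)
  have hmaps : MapsTo (fun t : ℝ => y + t • w) (Ioo (-ε) ε) Ω := fun t ht =>
    hball (by rwa [Real.ball_eq_Ioo, zero_sub, zero_add])
  exact ⟨fun t => r (y + t • w), ε, hε, (hr.restrict_scalars ℝ).comp hline.contDiffOn hmaps,
    fun t ht => hrS (hmaps ht), by simp,
    (hL.restrictScalars ℝ).comp_hasDerivAt_of_eq 0 hline' hy₀⟩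

end Tangent

section SliceMap

variable {𝕜 : Type*} [RCLike 𝕜] {V : Type*} [NormedAddCommGroup V] [NormedSpace 𝕜 V]

/-- A smooth map `σ` from an open set `Ω`, invariant under translations by the range of `D`, to the
fixed points of `D`, equivariant under these translations. Its zero set is a slice of the
translation action: it meets each orbit in `Ω` exactly once. -/
structure IsSliceMap (D : V →L[𝕜] V) (σ : V → V) (Ω : Set V) : Prop where
  isOpen : IsOpen Ω
  contDiffOn : ContDiffOn 𝕜 ∞ σ Ω
  proj_apply : ∀ x ∈ Ω, D (σ x) = σ x
  add_proj_mem : ∀ x ∈ Ω, ∀ z, x + D z ∈ Ω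
  apply_add_proj : ∀ x ∈ Ω, ∀ z, σ (x + D z) = σ x + D z

namespace IsSliceMap

variable {D : V →L[𝕜] V} {σ : V → V} {Ω : Set V}

theorem isIdempotentElem (h : IsSliceMap D σ Ω) (hΩ : Ω.Nonempty) : IsIdempotentElem D := by
  obtain ⟨x, hx⟩ := hΩ
  ext z
  have hfix := h.proj_apply _ (h.add_proj_mem x hx z)
  rwa [h.apply_add_proj x hx, map_add, h.proj_apply x hx, add_right_inj] at hfix

theorem proj_proj (h : IsSliceMap D σ Ω) {x : V} (hx : x ∈ Ω) (z : V) : D (D z) = D z :=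
  congr($(h.isIdempotentElem ⟨x, hx⟩) z)

theorem mapsTo_sub_apply (h : IsSliceMap D σ Ω) :
    MapsTo (fun x => x - σ x) Ω {x ∈ Ω | σ x = 0} := by
  intro x hx
  have hshift : x - σ x = x + D (-σ x) := by rw [map_neg, h.proj_apply x hx, sub_eq_add_neg]
  refine ⟨?_, ?_⟩ <;> dsimp only <;> rw [hshift]
  · exact h.add_proj_mem x hx _
  · rw [h.apply_add_proj x hx, map_neg, h.proj_apply x hx, add_neg_cancel]

theorem tangentSet_eq_ker (h : IsSliceMap D σ Ω) {x : V} (hx : x ∈ Ω) (hσx : σ x = 0)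
    {L : V →L[𝕜] V} (hL : HasFDerivAt σ L x) :
    tangentSet 𝕜 {y ∈ Ω | σ y = 0} x = L.ker := by
  refine (tangentSet_subset_ker hL fun y hy => hy.2).antisymm fun v hv => ?_
  have hvel := apply_mem_tangentSet h.isOpen hx
    (contDiffOn_id.sub (h.contDiffOn.of_le (by simp))) h.mapsTo_sub_apply
    ((hasFDerivAt_id x).sub hL) v
  have hLv : L v = 0 := hv
  simpa [hσx, hLv] using hvel

/-- The shear of `Ω` along the range of `D` which turns `σ` into the linear projection `D`. -/
noncomputable def chart (h : IsSliceMap D σ Ω) : OpenPartialHomeomorph V V where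
  toFun x := x + (σ x - D x)
  invFun y := y + (D y - σ y)
  source := Ω
  target := Ω
  map_source' x hx := by
    simpa [h.proj_apply x hx] using h.add_proj_mem x hx (σ x - x)
  map_target' y hy := by
    simpa [h.proj_apply y hy] using h.add_proj_mem y hy (y - σ y)
  left_inv' x hx := by
    have hσ : σ (x + (σ x - D x)) = σ x + (σ x - D x) := by
      simpa [h.proj_apply x hx] using h.apply_add_proj x hx (σ x - x)
    have hD : D (x + (σ x - D x)) = σ x := by simp [h.proj_apply x hx, h.proj_proj hx]
    rw [hσ, hD]
    abel
  right_inv' y hy := by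
    have hσ : σ (y + (D y - σ y)) = D y := by
      simpa [h.proj_apply y hy] using h.apply_add_proj y hy (y - σ y)
    have hD : D (y + (D y - σ y)) = D y + (D y - σ y) := by
      simp [h.proj_apply y hy, h.proj_proj hy]
    rw [hσ, hD]
    abel
  open_source := h.isOpen
  open_target := h.isOpen
  continuousOn_toFun :=
    continuousOn_id.add (h.contDiffOn.continuousOn.sub D.continuous.continuousOn)
  continuousOn_invFun :=
    continuousOn_id.add (D.continuous.continuousOn.sub h.contDiffOn.continuousOn)

theorem proj_chart (h : IsSliceMap D σ Ω) {x : V} (hx : x ∈ Ω) : D (h.chart x) = σ x := by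
  simp [chart, h.proj_apply x hx, h.proj_proj hx]

theorem image_chart (h : IsSliceMap D σ Ω) : h.chart '' {x ∈ Ω | σ x = 0} = Ω ∩ D.ker := by
  ext y
  constructor
  · rintro ⟨x, ⟨hx, hσx⟩, rfl⟩
    exact ⟨h.chart.map_source hx, (h.proj_chart hx).trans hσx⟩
  · rintro ⟨hy, hDy⟩
    have hx : h.chart.symm y ∈ Ω := h.chart.map_target hy
    refine ⟨h.chart.symm y, ⟨hx, ?_⟩, h.chart.right_inv hy⟩
    rw [← h.proj_chart hx, h.chart.right_inv hy]
    exact hDy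

theorem isSmoothSubmanifold (h : IsSliceMap D σ Ω) :
    IsSmoothSubmanifold 𝕜 {x ∈ Ω | σ x = 0} := by
  rintro x ⟨hx, -⟩
  have hD : IsIdempotentElem D := h.isIdempotentElem ⟨x, hx⟩
  refine ⟨D.ker, D.range, h.chart, D.isClosed_ker, hD.isClosed_range, hD.isTopCompl.isCompl.symm,
    hx, contDiffOn_id.add (h.contDiffOn.sub D.contDiff.contDiffOn),
    contDiffOn_id.add (D.contDiff.contDiffOn.sub h.contDiffOn), Ω, h.isOpen, ?_⟩
  rw [← h.image_chart, inter_eq_left.2 fun y hy => hy.1]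

end IsSliceMap

end SliceMap

section Operators

variable {𝕜 : Type*} [RCLike 𝕜]
  {E : Type*} [NormedAddCommGroup E] [NormedSpace 𝕜 E]
  {F : Type*} [NormedAddCommGroup F] [NormedSpace 𝕜 F]
  {G : Type*} [NormedAddCommGroup G] [NormedSpace 𝕜 G]
  {H : Type*} [NormedAddCommGroup H] [NormedSpace 𝕜 H]

/-- The two-sided multiplication `T ↦ P T Q` on bounded operators. -/
noncomputable def sandwich (P : F →L[𝕜] H) (Q : G →L[𝕜] E) : (E →L[𝕜] F) →L[𝕜] (G →L[𝕜] H) :=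
  P.postcomp G ∘L Q.precomp F

theorem sandwich_apply (P : F →L[𝕜] H) (Q : G →L[𝕜] E) (T : E →L[𝕜] F) :
    sandwich P Q T = P ∘L T ∘L Q := rfl

theorem cafagna_eq_ker_sandwich {X : E →L[𝕜] F} {Y : F →L[𝕜] E} (hXY : X ∘L Y ∘L X = X) :
    cafagna X = (sandwich (1 - X ∘L Y) (1 - Y ∘L X)).ker := by
  have hXY' : ∀ e, X (Y (X e)) = X e := fun e => congr($hXY e)
  have happly : ∀ T e, sandwich (1 - X ∘L Y) (1 - Y ∘L X) T e =
      T (e - Y (X e)) - X (Y (T (e - Y (X e)))) := fun _ _ => rfl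
  ext T
  constructor
  · intro hT
    refine ContinuousLinearMap.ext fun e => ?_
    obtain ⟨d, hd : X d = T (e - Y (X e))⟩ := hT (e - Y (X e)) (by rw [map_sub, hXY', sub_self])
    rw [coe_coe, happly, ← hd, hXY', sub_self, zero_apply]
  · intro hT e he
    have hTe : sandwich (1 - X ∘L Y) (1 - Y ∘L X) T e = 0 := congr($hT e)
    rw [happly, he, map_zero, sub_zero, sub_eq_zero] at hTe
    exact ⟨Y (T e), hTe.symm⟩

/-- The operators `X` whose compression `V X U` is invertible. -/
def regularLocus (U : G →L[𝕜] E) (V : F →L[𝕜] G) : Set (E →L[𝕜] F) :=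
  {X | IsUnit (V ∘L X ∘L U)}

/-- The outer inverse `Y` of `X` (`Y X Y = Y`) with range `R(U)` and null space `N(V)`. It is the
junk value `0` outside of `regularLocus U V`. -/
noncomputable def outerInverse (U : G →L[𝕜] E) (V : F →L[𝕜] G) (X : E →L[𝕜] F) : F →L[𝕜] E :=
  U ∘L Ring.inverse (V ∘L X ∘L U) ∘L V

/-- The Schur complement `X - X U (V X U)⁻¹ V X` of the compression `V X U` in `X`, as an operator
between the full spaces rather than between complements of `R(U)` and `R(V)`. -/
noncomputable def schurComplement (U : G →L[𝕜] E) (V : F →L[𝕜] G) (X : E →L[𝕜] F) : E →L[𝕜] F :=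
  X - X ∘L outerInverse U V X ∘L X

variable {U : G →L[𝕜] E} {V : F →L[𝕜] G} {X A : E →L[𝕜] F}

theorem comp_comp_outerInverse (hX : X ∈ regularLocus U V) : V ∘L X ∘L outerInverse U V X = V := by
  ext y
  exact congr($(Ring.mul_inverse_cancel _ hX) (V y))

theorem outerInverse_comp_comp (hX : X ∈ regularLocus U V) : outerInverse U V X ∘L X ∘L U = U := by
  ext y
  exact congr(U ($(Ring.inverse_mul_cancel _ hX) y))

theorem comp_schurComplement (hX : X ∈ regularLocus U V) : V ∘L schurComplement U V X = 0 := by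
  ext e
  simpa [schurComplement, sub_eq_zero] using congr($((comp_comp_outerInverse hX).symm) (X e))

theorem schurComplement_comp (hX : X ∈ regularLocus U V) : schurComplement U V X ∘L U = 0 := by
  ext y
  simpa [schurComplement, sub_eq_zero] using congr(X ($((outerInverse_comp_comp hX).symm) y))

theorem outerInverse_add {Z : E →L[𝕜] F} (hZ : V ∘L Z = 0) :
    outerInverse U V (X + Z) = outerInverse U V X := by
  rw [outerInverse, add_comp, comp_add, ← comp_assoc V Z, hZ, zero_comp, add_zero, outerInverse]

theorem add_mem_regularLocus {Z : E →L[𝕜] F} (hX : X ∈ regularLocus U V) (hZ : V ∘L Z = 0) :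
    X + Z ∈ regularLocus U V := by
  rwa [regularLocus, mem_ofPred_eq, add_comp, comp_add, ← comp_assoc V Z, hZ, zero_comp, add_zero]

theorem schurComplement_add {Z : E →L[𝕜] F} (hVZ : V ∘L Z = 0) (hZU : Z ∘L U = 0) :
    schurComplement U V (X + Z) = schurComplement U V X + Z := by
  have hVZ' : ∀ e, V (Z e) = 0 := fun e => congr($hVZ e)
  have hZU' : ∀ g, Z (U g) = 0 := fun g => congr($hZU g)
  ext e
  simp only [schurComplement, outerInverse_add hVZ]
  simp only [outerInverse, sub_apply, add_apply, coe_comp, Function.comp_apply, map_add, hVZ',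
    hZU', add_zero]
  abel

theorem zero_notMem_regularLocus [Nontrivial G] : (0 : E →L[𝕜] F) ∉ regularLocus U V := by
  simp [regularLocus]

variable [CompleteSpace G]

theorem isOpen_regularLocus (U : G →L[𝕜] E) (V : F →L[𝕜] G) : IsOpen (regularLocus U V) :=
  Units.isOpen.preimage (by fun_prop : Continuous fun X => V ∘L X ∘L U)

theorem contDiffOn_schurComplement (U : G →L[𝕜] E) (V : F →L[𝕜] G) :
    ContDiffOn 𝕜 ∞ (schurComplement U V) (regularLocus U V) := by
  have hinv : ContDiffOn 𝕜 ∞ (fun X => Ring.inverse (V ∘L X ∘L U)) (regularLocus U V) := by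
    rintro X ⟨u, hu⟩
    have hu' : ContDiffAt 𝕜 ∞ Ring.inverse (V ∘L X ∘L U) := hu ▸ contDiffAt_ringInverse 𝕜 u
    have hcomp : ContDiff 𝕜 ∞ fun X : E →L[𝕜] F => V ∘L X ∘L U := by fun_prop
    exact (hu'.comp X hcomp.contDiffAt).contDiffWithinAt
  unfold schurComplement outerInverse
  fun_prop

theorem hasFDerivAt_outerInverse (hX : X ∈ regularLocus U V) :
    HasFDerivAt (outerInverse U V) (-sandwich (outerInverse U V X) (outerInverse U V X)) X := by
  obtain ⟨u, hu⟩ := hX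
  have hinv : HasFDerivAt Ring.inverse _ (V ∘L X ∘L U) := hu ▸ hasFDerivAt_ringInverse (𝕜 := 𝕜) u
  have hderiv := (sandwich U V).hasFDerivAt.comp X (hinv.comp X (sandwich V U).hasFDerivAt)
  refine hderiv.congr_fderiv ?_
  ext T y
  simp [sandwich_apply, outerInverse, ← hu]

theorem hasFDerivAt_schurComplement (hX : X ∈ regularLocus U V) :
    HasFDerivAt (schurComplement U V)
      (sandwich (1 - X ∘L outerInverse U V X) (1 - outerInverse U V X ∘L X)) X := by
  refine ((hasFDerivAt_id X).sub ((hasFDerivAt_id X).clm_comp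
    ((hasFDerivAt_outerInverse hX).clm_comp (hasFDerivAt_id X)))).congr_fderiv ?_
  ext T e
  simp only [sandwich_apply, id_eq, id_apply, one_apply_eq_self, sub_apply, add_apply, neg_apply,
    comp_apply, flip_apply, compL_apply, comp_sub, comp_add, comp_neg, comp_id, sub_comp]
  abel

theorem isSliceMap_schurComplement (hA : A ∈ regularLocus U V) :
    IsSliceMap (sandwich (1 - A ∘L outerInverse U V A) (1 - outerInverse U V A ∘L A))
      (schurComplement U V) (regularLocus U V) := by
  have hV : V ∘L (1 - A ∘L outerInverse U V A) = 0 := by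
    rw [comp_sub, comp_comp_outerInverse hA]; exact sub_self V
  have hU : (1 - outerInverse U V A ∘L A) ∘L U = 0 := by
    rw [sub_comp, comp_assoc, outerInverse_comp_comp hA]; exact sub_self U
  have hVD : ∀ T, V ∘L sandwich (1 - A ∘L outerInverse U V A) (1 - outerInverse U V A ∘L A) T = 0 :=
    fun T => by rw [sandwich_apply, ← comp_assoc, hV, zero_comp]
  have hDU : ∀ T, sandwich (1 - A ∘L outerInverse U V A) (1 - outerInverse U V A ∘L A) T ∘L U = 0 :=
    fun T => by rw [sandwich_apply, comp_assoc, comp_assoc, hU, comp_zero, comp_zero]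
  exact
    { isOpen := isOpen_regularLocus U V
      contDiffOn := contDiffOn_schurComplement U V
      proj_apply := fun X hX => by
        have hVσ : ∀ e, V (schurComplement U V X e) = 0 := fun e =>
          congr($(comp_schurComplement hX) e)
        have hσU : ∀ g, schurComplement U V X (U g) = 0 := fun g =>
          congr($(schurComplement_comp hX) g)
        ext e
        simp [sandwich_apply, outerInverse, hVσ, hσU]
      add_proj_mem := fun X hX T => add_mem_regularLocus hX (hVD T)
      apply_add_proj := fun X _ T => schurComplement_add (hVD T) (hDU T) }

end Operators

section InnerInverse

variable {𝕜 : Type*} [RCLike 𝕜]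
  {E : Type*} [NormedAddCommGroup E] [NormedSpace 𝕜 E]
  {F : Type*} [NormedAddCommGroup F] [NormedSpace 𝕜 F]

theorem IsDoubleSplitting.exists_innerInverse [CompleteSpace E] [CompleteSpace F]
    {A : E →L[𝕜] F} (hA : IsDoubleSplitting A) : ∃ B : F →L[𝕜] E, A ∘L B ∘L A = A := by
  obtain ⟨hAc, ⟨R, hRc, hR⟩, N, hNc, hN⟩ := hA
  have := hRc.completeSpace_coe
  have hrange : (A ∘L R.subtypeL).range = A.range :=
    (LinearMap.range_domRestrict ..).trans (Submodule.map_eq_range_iff.2 hR.symm.codisjoint)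
  have hinj : Function.Injective (A ∘L R.subtypeL) :=
    LinearMap.injective_domRestrict_iff.2 hR.symm.disjoint
  have hclosed : IsClosed ((A ∘L R.subtypeL).range : Set F) := by rwa [hrange]
  have hcompl : (A ∘L R.subtypeL).range.ClosedComplemented := by
    rw [hrange]
    exact .of_isCompl_isClosed hN hAc hNc
  obtain ⟨L, hL⟩ :=
    HasLeftInverse.of_injective_of_isClosed_range_of_closedComplement_range hinj hclosed hcompl
  refine ⟨R.subtypeL ∘L L, ContinuousLinearMap.ext fun e => ?_⟩
  obtain ⟨r, hr : A r = A e⟩ : A e ∈ (A ∘L R.subtypeL).range := hrange ▸ ⟨e, rfl⟩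
  have hLr : L (A r) = r := hL r
  simp [← hr, hLr]

variable {A : E →L[𝕜] F} {B : F →L[𝕜] E}

theorem compression_eq_one (hAB : A ∘L B ∘L A = A) :
    (A.rangeRestrict ∘L B) ∘L A ∘L (B ∘L A.range.subtypeL) = 1 := by
  have hAB' : ∀ e, A (B (A e)) = A e := fun e => congr($hAB e)
  ext ⟨_, e, rfl⟩
  simp [hAB']

theorem outerInverse_self (hAB : A ∘L B ∘L A = A) :
    outerInverse (B ∘L A.range.subtypeL) (A.rangeRestrict ∘L B) A = B ∘L A ∘L B := by
  rw [outerInverse, compression_eq_one hAB, Ring.inverse_one]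
  rfl

end InnerInverse

end BanachFrobenius

open BanachFrobenius

theorem theorem4p1_general {𝕜 : Type*} [RCLike 𝕜]
    {E : Type*} [NormedAddCommGroup E] [NormedSpace 𝕜 E]
    {F : Type*} [NormedAddCommGroup F] [NormedSpace 𝕜 F]
    {A : E →L[𝕜] F} (hA₀ : A ≠ 0) (hAc : IsComplete (A.range : Set F))
    {B : F →L[𝕜] E} (hAB : A ∘L B ∘L A = A) :
    SmoothIntegrableAt 𝕜 {0}ᶜ (fun X : E →L[𝕜] F => cafagna X) A := by
  have : CompleteSpace A.range := hAc.completeSpace_coe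
  let U : A.range →L[𝕜] E := B ∘L A.range.subtypeL
  let V : F →L[𝕜] A.range := A.rangeRestrict ∘L B
  have hcomp : V ∘L A ∘L U = 1 := compression_eq_one hAB
  have hA : A ∈ regularLocus U V := by
    rw [regularLocus, mem_ofPred_eq, hcomp]; exact isUnit_one
  have hσA : schurComplement U V A = 0 := by
    rw [schurComplement, outerInverse_self hAB, comp_assoc, comp_assoc, hAB, hAB, sub_self]
  have hslice := isSliceMap_schurComplement hA
  have : Nontrivial A.range := Submodule.nontrivial_iff_ne_bot.2 fun h =>
    hA₀ (coe_injective (LinearMap.range_eq_bot.1 h))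
  refine ⟨{X ∈ regularLocus U V | schurComplement U V X = 0}, ⟨hA, hσA⟩, ?_,
    hslice.isSmoothSubmanifold, ?_⟩
  · rintro _ ⟨hX, -⟩ rfl
    exact zero_notMem_regularLocus hX
  · rintro X ⟨hX, hσX⟩
    have hM := cafagna_eq_ker_sandwich (sub_eq_zero.1 hσX).symm
    exact (congrArg _ hM).trans
      (hslice.tangentSet_eq_ker hX hσX (hasFDerivAt_schurComplement hX)).symm

theorem theorem4p1 {𝕜 : Type*} [RCLike 𝕜]
    {E : Type*} [NormedAddCommGroup E] [NormedSpace 𝕜 E] [CompleteSpace E]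
    {F : Type*} [NormedAddCommGroup F] [NormedSpace 𝕜 F] [CompleteSpace F]
    (A : E →L[𝕜] F) (hA₀ : A ∈ ({0}ᶜ : Set (E →L[𝕜] F)))
    (hA : BanachFrobenius.IsDoubleSplitting A) :
    BanachFrobenius.SmoothIntegrableAt 𝕜 ({0}ᶜ : Set (E →L[𝕜] F))
      (fun X => BanachFrobenius.cafagna X) A := by
  obtain ⟨B, hAB⟩ := hA.exists_innerInverse
  exact theorem4p1_general hA₀ hA.1.isComplete hAB
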